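/- Voters cast ballots, each a strict ranking of some or all of $n$ candidates, and a profile $P$ is a finite multiset of ballots. For $S$ seats, single transferable vote (STV) counts as follows. The quota is $\lfloor V/(S+1)\rfloor+1$, where $V$ is the number of voters. Each ballot is worth one vote and is first credited to its top candidate; every candidate whose vote total is at least the quota is elected, initially and again after every transfer. In each round, if some elected candidate's surplus (votes above the quota) has not been transferred yet, then the one with the largest vote total among such candidates has each of their ballots passed, with its value multiplied by surplus/(vote total), to the next candidate on it who is neither elected nor eliminated; otherwise a candidate with the fewest votes is eliminated and each of their ballots passes, at its current value, to the next candidate on it who is neither elected nor eliminated (a ballot without such a candidate is exhausted). The count stops when $S$ candidates are elected, or when the candidates elected and those remaining (neither elected nor eliminated) together number at most $S$, in which case those remaining win as well. When the winner set does not depend on how ties are broken, it is denoted $W(P,S)$. **Proposition.** Let $S>1$ be an integer. There exist a profile $P$ and a collection $\mathcal B$ of identical ballots, all ballots being complete rankings of the candidates, such that, with $P'$ the profile obtained by adding the ballots of $\mathcal B$ to $P$, the winner sets $W(P,S)$ and $W(P',S)$ do not depend on how ties are broken, and 1. every candidate in $W(P,S)$ is ranked in the top $S$ slots on the ballots in $\mathcal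 B$; 2. $|W(P,S)\cap W(P',S)|=1$, and none of the top $S-1$ candidates on the ballots in $\mathcal B$ is in $W(P',S)$; 3. every candidate in the bottom $S-1$ positions on the ballots in $\mathcal B$ is in $W(P',S)$. Moreover, $P$ and $\mathcal B$ can be chosen with $4$ candidates, $1000$ voters in $P$ and $3$ ballots in $\mathcal B$ if $S=2$, and with $2S-1$ candidates, $(S+1)\cdot 10^S$ voters in $P$ and $2(S+1)$ ballots in $\mathcal B$ if $S>2$. -/

import Mathlib

namespace STV

/-- A ballot: a nonempty strict ranking, most preferred first, of some or all of the candidates. -/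
structure Ballot (C : Type) where
  ranking : List C
  nodup : ranking.Nodup
  nonempty : ranking ≠ []

namespace Ballot

/-- The ballot ranks every candidate. -/
def IsComplete {C : Type} (b : Ballot C) : Prop := ∀ c : C, c ∈ b.ranking

/-- The candidates in the top `k` slots of the ballot. -/
def top {C : Type} (b : Ballot C) (k : ℕ) : List C := b.ranking.take k

/-- The candidates in the bottom `k` slots of the ballot. -/
def bottom {C : Type} (b : Ballot C) (k : ℕ) : List C :=
  b.ranking.drop (b.ranking.length - k)

end Ballot

/-- A preference profile: one ballot for each voter, the voters being anonymous. -/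
abbrev Profile (C : Type) : Type := Multiset (Ballot C)

/-- The quota `⌊(number of voters) / (S + 1)⌋ + 1` for `S` seats. -/
def quota {C : Type} (P : Profile C) (S : ℕ) : ℕ := P.card / (S + 1) + 1

/-- The state of the count between two rounds. Identical ballots are always treated alike, so
the holder and the value are recorded for each kind of ballot. -/
structure State (C : Type) where
  /-- candidates who are neither elected nor eliminated -/
  hopeful : Finset C
  /-- candidates elected by reaching the quota -/
  elected : Finset C
  /-- elected candidates whose surplus has not been transferred yet -/
  pending : Finset C
  /-- the candidate to whom such a ballot is currently credited (`none`: exhausted) -/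
  holder : Ballot C → Option C
  /-- the (fractional) vote that each such ballot is currently worth -/
  value : Ballot C → ℚ

namespace State

variable {C : Type} [DecidableEq C]

/-- The current (first-place) vote total of the candidate `c`. -/
def votes (P : Profile C) (s : State C) (c : C) : ℚ :=
  ((P.filter fun b => s.holder b = some c).map s.value).sum

/-- Declare elected all hopeful candidates whose vote total has reached the quota. -/
def declare (P : Profile C) (S : ℕ) (s : State C) : State C :=
  let new := s.hopeful.filter fun c => (quota P S : ℚ) ≤ s.votes P c
  { s with
    hopeful := s.hopeful \ new
    elected := s.elected ∪ new
    pending := s.pending ∪ new }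

/-- Eliminate `c`: each ballot held by `c` passes, at its current value, to the next candidate on
it who is neither elected nor eliminated. -/
def eliminate (s : State C) (c : C) : State C :=
  { s with
    hopeful := s.hopeful.erase c
    holder := fun b =>
      if s.holder b = some c then b.ranking.find? fun d => decide (d ∈ s.hopeful.erase c)
      else s.holder b }

/-- Transfer the surplus of the elected candidate `c`: each ballot held by `c` passes to the next
candidate on it who is neither elected nor eliminated, its value multiplied by
`(votes of c - quota) / (votes of c)`. -/
def transferSurplus (P : Profile C) (S : ℕ) (s : State C) (c : C) : State C :=
  { s with
    pending := s.pending.erase c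
    holder := fun b =>
      if s.holder b = some c then b.ranking.find? fun d => decide (d ∈ s.hopeful)
      else s.holder b
    value := fun b =>
      if s.holder b = some c then s.value b * ((s.votes P c - quota P S) / s.votes P c)
      else s.value b }

/-- The state before anybody is elected: each ballot is worth one vote and is credited to the
candidate ranked first on it. -/
def initial (C : Type) [Fintype C] : State C where
  hopeful := Finset.univ
  elected := ∅
  pending := ∅
  holder := fun b => b.ranking.head?
  value := fun _ => 1

/-- There is a seat to fill, and more candidates are left than can be seated. -/
def Running (S : ℕ) (s : State C) : Prop :=
  s.elected.card < S ∧ S < s.elected.card + s.hopeful.card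

/-- `s.Elects P S W`: from the state `s`, the count can end with the winner set `W`. While the
count is running, the largest untransferred surplus is transferred if there is one, and otherwise
a candidate with the fewest votes is eliminated; ties may be broken in any way. -/
inductive Elects (P : Profile C) (S : ℕ) : State C → Finset C → Prop
  | full (s : State C) (h : s.elected.card = S) : Elects P S s s.elected
  | fill (s : State C) (h : s.elected.card + s.hopeful.card ≤ S) :
      Elects P S s (s.elected ∪ s.hopeful)
  | surplus (s : State C) (c : C) (W : Finset C) (hs : s.Running S)
      (hc : c ∈ s.pending) (hmax : ∀ d ∈ s.pending, s.votes P d ≤ s.votes P c)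
      (h : Elects P S ((s.transferSurplus P S c).declare P S) W) : Elects P S s W
  | elimination (s : State C) (c : C) (W : Finset C) (hs : s.Running S)
      (hp : s.pending = ∅) (hc : c ∈ s.hopeful)
      (hmin : ∀ d ∈ s.hopeful, s.votes P c ≤ s.votes P d)
      (h : Elects P S ((s.eliminate c).declare P S) W) : Elects P S s W

end State

/-- `W` is a possible winner set of the election `(P, S)`, for some way to break ties. -/
def IsWinnerSet {C : Type} [Fintype C] [DecidableEq C] (P : Profile C) (S : ℕ)
    (W : Finset C) : Prop :=
  ((State.initial C).declare P S).Elects P S W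

/-- `W(P, S) = W`: whichever way ties are broken, the winner set of `(P, S)` is `W`. -/
def WinnersEq {C : Type} [Fintype C] [DecidableEq C] (P : Profile C) (S : ℕ)
    (W : Finset C) : Prop :=
  ∀ X : Finset C, IsWinnerSet P S X ↔ X = W

end STV

/-!
For `S > 2` there are `2 * S - 1` candidates: the first winner `m`, and two rows of `S - 1`
candidates each, one below and one above `m` on the ballots added. All candidates but `m` start
below the quota. In `P` the surplus of `m` is two votes, and it goes to the first candidate of the
lower row. With this help that candidate overtakes the first candidate of the upper row, who is
eliminated instead. The ballots added raise the quota by two votes, so that no surplus is left to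
transfer, and the first candidate of the lower row is eliminated. Either elimination starts a
cascade: every candidate of the losing row in turn has fewest votes, and its ballots pass to the
other row, where they push some totals to just below the quota but never lift anyone to it. Hence
no further surplus arises, and the surviving row wins the last `S - 1` seats with `m`.
-/

namespace STV

variable {C : Type} [DecidableEq C]

namespace Ballot

/-- The most preferred member of `H` on the ballot, to whom the ballot is credited when `H` is the
set of hopeful candidates. -/
def next (b : Ballot C) (H : Finset C) : Option C :=
  b.ranking.find? fun d => decide (d ∈ H)

/-- The ballot with `c` moved to the first place (or inserted there, if `b` does not rank `c`). -/
def promote (b : Ballot C) (c : C) : Ballot C where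
  ranking := c :: b.ranking.filter (· ≠ c)
  nodup := List.nodup_cons.2 ⟨by simp, b.nodup.filter _⟩
  nonempty := List.cons_ne_nil _ _

/-- The ballot with `x` moved to the first and `y` to the second place, where `x ≠ y`. -/
def promotePair (b : Ballot C) (x y : C) : Ballot C := (b.promote y).promote x

variable {b : Ballot C} {H K : Finset C} {c : C}

theorem mem_of_next_eq_some (h : b.next H = some c) : c ∈ H := by
  simpa using List.find?_some h

theorem next_eq_some_of_subset (hKH : K ⊆ H) (hc : c ∈ K) (h : b.next H = some c) :
    b.next K = some c := by
  obtain ⟨-, l, l', hb, hl⟩ := List.find?_eq_some_iff_append.1 h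
  refine List.find?_eq_some_iff_append.2 ⟨by simpa using hc, l, l', hb, fun d hd => ?_⟩
  have hdH : d ∉ H := by simpa using hl d hd
  simpa using fun hdK => hdH (hKH hdK)

theorem next_erase (h : b.next H ≠ some c) : b.next (H.erase c) = b.next H := by
  cases hd : b.next H with
  | none =>
    refine List.find?_eq_none.2 fun d hdb => ?_
    have hdH : d ∉ H := by simpa using List.find?_eq_none.1 hd d hdb
    simpa using fun _ => hdH
  | some d =>
    have hdc : d ≠ c := fun hdc => h (hdc ▸ hd)
    exact next_eq_some_of_subset (H.erase_subset c)
      (Finset.mem_erase.2 ⟨hdc, mem_of_next_eq_some hd⟩) hd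

theorem ite_next_erase (b : Ballot C) (H : Finset C) (c : C) :
    (if b.next H = some c then b.next (H.erase c) else b.next H) = b.next (H.erase c) := by
  split_ifs with h
  · rfl
  · exact (next_erase h).symm

theorem next_univ [Fintype C] (b : Ballot C) : b.next Finset.univ = b.ranking.head? := by
  cases hb : b.ranking <;> simp [next, hb]

theorem next_promote (b : Ballot C) (c : C) (H : Finset C) :
    (b.promote c).next H = if c ∈ H then some c else b.next H := by
  split_ifs with hc
  · simp [promote, next, hc]
  · have hfind : (fun d => decide (d ≠ c) && decide (d ∈ H)) = fun d => decide (d ∈ H) := by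
      ext d
      by_cases hd : d = c <;> simp [hd, hc]
    simp only [promote, next, List.find?_cons_of_neg, hc, decide_false, Bool.false_eq_true,
      not_false_eq_true, List.find?_filter, Bool.decide_eq_true, Bool.decide_and, hfind]

theorem next_promotePair (b : Ballot C) (x y : C) (H : Finset C) :
    (b.promotePair x y).next H = if x ∈ H then some x else if y ∈ H then some y else b.next H := by
  rw [promotePair, next_promote, next_promote]

theorem IsComplete.promote (hb : b.IsComplete) (c : C) : (b.promote c).IsComplete := fun d => by
  by_cases hd : d = c <;> simp [Ballot.promote, hd, hb d]

theorem IsComplete.promotePair (hb : b.IsComplete) (x y : C) : (b.promotePair x y).IsComplete :=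
  (hb.promote y).promote x

end Ballot

/-- The vote total of `c` when each ballot `b` of `P` is worth `w b` and is credited to the most
preferred member of `H` on it. -/
def tally (P : Profile C) (w : Ballot C → ℚ) (H : Finset C) (c : C) : ℚ :=
  ((P.filter fun b => b.next H = some c).map w).sum

/-- The values of the ballots after those credited to `m` have been transferred with the
factor `ρ`, where `w` gives the values and `H` the hopeful candidates before the transfer. -/
def discount (w : Ballot C → ℚ) (H : Finset C) (m : C) (ρ : ℚ) (b : Ballot C) : ℚ :=
  if b.next H = some m then w b * ρ else w b

section Tally

variable {P : Profile C} {w : Ballot C → ℚ} {H : Finset C} {c : C}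

theorem tally_add (P Q : Profile C) (w : Ballot C → ℚ) (H : Finset C) (c : C) :
    tally (P + Q) w H c = tally P w H c + tally Q w H c := by
  simp [tally]

theorem tally_sum {ι : Type*} (s : Finset ι) (P : ι → Profile C) (w : Ballot C → ℚ)
    (H : Finset C) (c : C) : tally (∑ i ∈ s, P i) w H c = ∑ i ∈ s, tally (P i) w H c :=
  map_sum (⟨⟨fun P => tally P w H c, by simp [tally]⟩, fun P Q => tally_add P Q w H c⟩ :
    Profile C →+ ℚ) P s

theorem tally_eq_zero (h : ∀ b ∈ P, b.next H ≠ some c) : tally P w H c = 0 := by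
  simp [tally, Multiset.filter_eq_nil.2 h]

theorem tally_replicate (k : ℕ) (b : Ballot C) (w : Ballot C → ℚ) (H : Finset C) (c : C) :
    tally (Multiset.replicate k b) w H c = if b.next H = some c then k * w b else 0 := by
  split_ifs with h
  · have hall : ∀ a ∈ Multiset.replicate k b, a.next H = some c := fun a ha =>
      Multiset.eq_of_mem_replicate ha ▸ h
    simp [tally, Multiset.filter_eq_self.2 hall]
  · exact tally_eq_zero fun a ha => Multiset.eq_of_mem_replicate ha ▸ h

theorem tally_le_tally_discount {m : C} {ρ : ℚ} (hw : ∀ b, 0 ≤ w b) (hρ : 0 ≤ ρ) (hc : c ∈ H)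
    (hcm : c ≠ m) :
    tally P w H c ≤ tally P (discount w H m ρ) (H.erase m) c := by
  have hfilter : P.filter (fun b => b.next H = some c) ≤
      P.filter fun b => b.next (H.erase m) = some c :=
    Multiset.monotone_filter_right P fun b hb =>
      Ballot.next_eq_some_of_subset (H.erase_subset m) (Finset.mem_erase.2 ⟨hcm, hc⟩) hb
  have hvalue : tally P w H c =
      ((P.filter fun b => b.next H = some c).map (discount w H m ρ)).sum := by
    refine congrArg Multiset.sum (Multiset.map_congr rfl fun b hb => ?_)
    have hbm : b.next H ≠ some m := by simpa [(Multiset.mem_filter.1 hb).2] using hcm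
    exact (if_neg hbm).symm
  obtain ⟨R, hR⟩ := Multiset.le_iff_exists_add.1 hfilter
  rw [hvalue, tally, hR, Multiset.map_add, Multiset.sum_add]
  refine le_add_of_nonneg_right (Multiset.sum_nonneg fun x hx => ?_)
  obtain ⟨b, -, rfl⟩ := Multiset.mem_map.1 hx
  unfold discount
  split_ifs
  · exact mul_nonneg (hw b) hρ
  · exact hw b

theorem discount_promotePair [Fintype C] (b : Ballot C) (m x y : C) (ρ : ℚ) :
    discount 1 Finset.univ m ρ (b.promotePair x y) = if x = m then ρ else 1 := by
  simp [discount, Ballot.next_promotePair]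

end Tally

namespace State

/-- Whichever way ties are broken, the count ends with the winner set `W` when it is continued
from the state `s`. -/
def ElectsOnly (P : Profile C) (S : ℕ) (s : State C) (W : Finset C) : Prop :=
  ∀ X, s.Elects P S X ↔ X = W

/-- The state with hopeful candidates `H` and elected candidates `E` in which no surplus is pending
and each ballot `b` is worth `w b` and is credited to the most preferred member of `H` on it. -/
def settled (w : Ballot C → ℚ) (H E : Finset C) : State C where
  hopeful := H
  elected := E
  pending := ∅
  holder b := b.next H
  value := w

variable {P : Profile C} {S : ℕ} {s : State C} {W : Finset C} {c : C}

theorem electsOnly_of_full (h : s.elected.card = S) : s.ElectsOnly P S s.elected := fun X => by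
  refine ⟨fun hX => ?_, fun hX => hX ▸ .full s h⟩
  cases hX with
  | full => rfl
  | fill _ h' => simp [Finset.card_eq_zero.1 (by omega : s.hopeful.card = 0)]
  | surplus _ _ _ hs => exact absurd hs.1 (by omega)
  | elimination _ _ _ hs => exact absurd hs.1 (by omega)

theorem electsOnly_of_fill (h : s.elected.card + s.hopeful.card ≤ S) :
    s.ElectsOnly P S (s.elected ∪ s.hopeful) := fun X => by
  refine ⟨fun hX => ?_, fun hX => hX ▸ .fill s h⟩
  cases hX with
  | full _ h' => simp [Finset.card_eq_zero.1 (by omega : s.hopeful.card = 0)]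
  | fill => rfl
  | surplus _ _ _ hs => exact absurd hs.2 (by omega)
  | elimination _ _ _ hs => exact absurd hs.2 (by omega)

theorem electsOnly_of_transferSurplus (hs : s.Running S) (hc : c ∈ s.pending)
    (hmax : ∀ d ∈ s.pending, d ≠ c → s.votes P d < s.votes P c)
    (h : ((s.transferSurplus P S c).declare P S).ElectsOnly P S W) : s.ElectsOnly P S W :=
  fun X => by
    rw [← h X]
    refine ⟨fun hX => ?_, .surplus s c X hs hc fun d hd => ?_⟩
    · cases hX with
      | full _ h' => exact absurd hs.1 (by omega)
      | fill _ h' => exact absurd hs.2 (by omega)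
      | surplus _ d _ _ hd hd' hX' =>
        obtain rfl : d = c := by
          by_contra hdc
          exact (hmax d hd hdc).not_ge (hd' c hc)
        exact hX'
      | elimination _ _ _ _ hp => simp [hp] at hc
    · rcases eq_or_ne d c with rfl | hdc
      · exact le_rfl
      · exact (hmax d hd hdc).le

theorem electsOnly_of_eliminate (hs : s.Running S) (hp : s.pending = ∅) (hc : c ∈ s.hopeful)
    (hmin : ∀ d ∈ s.hopeful, d ≠ c → s.votes P c < s.votes P d)
    (h : ((s.eliminate c).declare P S).ElectsOnly P S W) : s.ElectsOnly P S W :=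
  fun X => by
    rw [← h X]
    refine ⟨fun hX => ?_, .elimination s c X hs hp hc fun d hd => ?_⟩
    · cases hX with
      | full _ h' => exact absurd hs.1 (by omega)
      | fill _ h' => exact absurd hs.2 (by omega)
      | surplus _ d _ _ hd => simp [hp] at hd
      | elimination _ d _ _ _ hd hd' hX' =>
        obtain rfl : d = c := by
          by_contra hdc
          exact (hmin d hd hdc).not_ge (hd' c hc)
        exact hX'
    · rcases eq_or_ne d c with rfl | hdc
      · exact le_rfl
      · exact (hmin d hd hdc).le

theorem declare_eq_self (h : ∀ c ∈ s.hopeful, s.votes P c < quota P S) : s.declare P S = s := by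
  have hnew : (s.hopeful.filter fun c => (quota P S : ℚ) ≤ s.votes P c) = ∅ :=
    Finset.filter_eq_empty_iff.2 fun c hc => (h c hc).not_ge
  simp [declare, hnew]

theorem electsOnly_declare_of_fill (h : s.elected.card + s.hopeful.card ≤ S) :
    (s.declare P S).ElectsOnly P S (s.elected ∪ s.hopeful) := by
  set N := s.hopeful.filter fun c => (quota P S : ℚ) ≤ s.votes P c
  have hN : N ⊆ s.hopeful := Finset.filter_subset _ _
  have hunion : s.elected ∪ s.hopeful = s.elected ∪ N ∪ s.hopeful \ N := by
    rw [Finset.union_assoc, Finset.union_sdiff_of_subset hN]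
  rw [hunion]
  refine electsOnly_of_fill ?_
  calc (s.elected ∪ N).card + (s.hopeful \ N).card
      ≤ s.elected.card + N.card + (s.hopeful \ N).card := by
        gcongr
        exact Finset.card_union_le _ _
    _ = s.elected.card + s.hopeful.card := by
        rw [← Finset.card_sdiff_add_card_eq_card hN]
        ring
    _ ≤ S := h

section Settled

variable {w : Ballot C → ℚ} {H E : Finset C} {m : C}

theorem initial_eq_settled [Fintype C] : initial C = settled 1 Finset.univ ∅ := by
  simp only [initial, settled, Ballot.next_univ]
  rfl

theorem eliminate_settled : (settled w H E).eliminate c = settled w (H.erase c) E := by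
  simp only [eliminate, settled, State.mk.injEq, true_and, and_true]
  exact funext fun b => b.ite_next_erase H c

theorem declare_settled (hm : m ∈ H) (hmq : quota P S ≤ tally P w H m)
    (hq : ∀ c ∈ H, c ≠ m → tally P w H c < quota P S) :
    (settled w H E).declare P S =
      { settled w H E with hopeful := H.erase m, elected := insert m E, pending := {m} } := by
  have hnew : (H.filter fun c => (quota P S : ℚ) ≤ (settled w H E).votes P c) = {m} := by
    ext c
    rw [Finset.mem_filter, Finset.mem_singleton]
    refine ⟨fun ⟨hc, hcq⟩ => ?_, fun hc => hc ▸ ⟨hm, hmq⟩⟩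
    by_contra hcm
    exact (hq c hc hcm).not_ge hcq
  simp only [declare, settled] at hnew ⊢
  simp only [hnew, Finset.sdiff_singleton_eq_erase, Finset.union_singleton,
    insert_empty_eq]

theorem electsOnly_declare_settled_of_eliminate (hE : E.card < S) (hH : S < E.card + H.card)
    (hq : ∀ d ∈ H, tally P w H d < quota P S) (hc : c ∈ H)
    (hmin : ∀ d ∈ H, d ≠ c → tally P w H c < tally P w H d)
    (h : ((settled w (H.erase c) E).declare P S).ElectsOnly P S W) :
    ((settled w H E).declare P S).ElectsOnly P S W := by
  rw [declare_eq_self (s := settled w H E) hq]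
  exact electsOnly_of_eliminate ⟨hE, hH⟩ rfl hc hmin
    (by rwa [eliminate_settled])

theorem electsOnly_declare_settled_of_full (hm : m ∈ H) (hmq : quota P S ≤ tally P w H m)
    (hq : ∀ c ∈ H, c ≠ m → tally P w H c < quota P S) (hE : (insert m E).card = S) :
    ((settled w H E).declare P S).ElectsOnly P S (insert m E) := by
  rw [declare_settled hm hmq hq]
  exact electsOnly_of_full hE

theorem electsOnly_declare_settled_of_transferSurplus (hE : (insert m E).card < S)
    (hH : S < (insert m E).card + (H.erase m).card) (hm : m ∈ H)
    (hmq : quota P S ≤ tally P w H m) (hq : ∀ c ∈ H, c ≠ m → tally P w H c < quota P S)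
    (h : ((settled (discount w H m ((tally P w H m - quota P S) / tally P w H m)) (H.erase m)
      (insert m E)).declare P S).ElectsOnly P S W) :
    ((settled w H E).declare P S).ElectsOnly P S W := by
  rw [declare_settled hm hmq hq]
  refine electsOnly_of_transferSurplus ⟨hE, hH⟩ (Finset.mem_singleton_self m) (by simp) ?_
  convert h using 2
  simp only [transferSurplus, settled, State.mk.injEq, Finset.erase_singleton, true_and]
  exact ⟨funext fun b => b.ite_next_erase H m, rfl⟩

theorem electsOnly_declare_settled_of_eliminations {n : ℕ} {R : ℕ → Finset C} {v : ℕ → C}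
    (hv : ∀ k < n, v k ∈ R k) (hR : ∀ k < n, R (k + 1) = (R k).erase (v k)) (hE : E.card < S)
    (hS : E.card + (R n).card = S)
    (hq : ∀ k < n, ∀ d ∈ R k, tally P w (R k) d < quota P S)
    (hmin : ∀ k < n, ∀ d ∈ R k, d ≠ v k → tally P w (R k) (v k) < tally P w (R k) d) :
    ((settled w (R 0) E).declare P S).ElectsOnly P S (E ∪ R n) := by
  have hcard : ∀ k ≤ n, (R k).card = (R n).card + (n - k) := fun k hk => by
    induction hk using Nat.decreasingInduction with
    | self => omega
    | of_succ k hk ih =>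
      have := Finset.card_erase_add_one (hv k hk)
      rw [hR k hk] at ih
      omega
  suffices h : ∀ k ≤ n, ((settled w (R k) E).declare P S).ElectsOnly P S (E ∪ R n) from
    h 0 n.zero_le
  intro k hk
  induction hk using Nat.decreasingInduction with
  | self => exact electsOnly_declare_of_fill (s := settled w (R n) E) hS.le
  | of_succ k hk ih =>
    have hrunning : S < E.card + (R k).card := by
      have := hcard k hk.le
      omega
    exact electsOnly_declare_settled_of_eliminate hE hrunning (hq k hk) (hv k hk) (hmin k hk)
      (hR k hk ▸ ih)

end Settled

end State

theorem winnersEq_iff [Fintype C] {P : Profile C} {S : ℕ} {W : Finset C} :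
    WinnersEq P S W ↔ ((State.settled 1 Finset.univ ∅).declare P S).ElectsOnly P S W := by
  rw [← State.initial_eq_settled]
  rfl

/-- The ballot ranking the candidates in increasing order, which is the ballot added to the profiles
below. -/
def increasing (N : ℕ) [NeZero N] : Ballot (Fin N) where
  ranking := List.finRange N
  nodup := List.nodup_finRange N
  nonempty := by simpa using NeZero.ne N

section Increasing

variable {N k : ℕ} [NeZero N] {c : Fin N} {H : Finset (Fin N)}

theorem next_increasing (h : 0 ∈ H) : (increasing N).next H = some 0 := by
  obtain ⟨n, rfl⟩ := Nat.exists_eq_succ_of_ne_zero (NeZero.ne N)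
  exact (congrArg _ List.finRange_succ).trans (List.find?_cons_of_pos (by simpa using h))

theorem isComplete_increasing : (increasing N).IsComplete := List.mem_finRange

theorem mem_top_increasing : c ∈ (increasing N).top k ↔ (c : ℕ) < k := by
  simp only [Ballot.top, increasing, List.mem_take_iff_getElem, List.getElem_finRange,
    List.length_finRange]
  exact ⟨fun ⟨i, hi, hc⟩ => by simp [← hc]; omega, fun h => ⟨c, by omega, rfl⟩⟩

theorem mem_bottom_increasing : c ∈ (increasing N).bottom k ↔ N - k ≤ (c : ℕ) := by
  simp only [Ballot.bottom, increasing, List.mem_drop_iff_getElem, List.getElem_finRange,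
    List.length_finRange]
  exact ⟨fun ⟨i, hi, hc⟩ => by simp [← hc], fun h => ⟨c - (N - k), by omega, by ext; simp; omega⟩⟩

end Increasing

/-- The paradox of the proposition: all ballots being complete, the candidates elected from `P` all
stand in the top `S` slots of `b`, and the addition of `k` ballots `b` unseats all but one of them,
and all of the top `S - 1` candidates on `b`, in favour of the bottom `S - 1`. -/
def IsParadox {C : Type} [Fintype C] [DecidableEq C] (S : ℕ) (P : Profile C) (b : Ballot C) (k : ℕ)
    (W W' : Finset C) : Prop :=
  (∀ a ∈ P, a.IsComplete) ∧ b.IsComplete ∧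
    WinnersEq P S W ∧ WinnersEq (P + Multiset.replicate k b) S W' ∧
    (∀ c ∈ W, c ∈ b.top S) ∧ (W ∩ W').card = 1 ∧ (∀ c ∈ b.top (S - 1), c ∉ W') ∧
    ∀ c ∈ b.bottom (S - 1), c ∈ W'

section TwoSeats

/-- A profile for two seats in which candidate `1` is elected first. Two thirds of the surplus of
`1` go to `2`, who is one vote short of `3`; these two thirds exceed one vote when the surplus is
`2`, but not when the quota has grown by one. -/
def twoSeatProfile (r : ℕ) : Profile (Fin 4) :=
  Multiset.replicate 224 ((increasing 4).promotePair 1 2) +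
  Multiset.replicate 112 ((increasing 4).promote 1) +
  Multiset.replicate 180 ((increasing 4).promotePair 2 3) +
  Multiset.replicate 181 ((increasing 4).promote 3) +
  Multiset.replicate r (increasing 4)

theorem card_twoSeatProfile (r : ℕ) : (twoSeatProfile r).card = 697 + r := by
  simp only [twoSeatProfile, Multiset.card_add, Multiset.card_replicate]

theorem isComplete_of_mem_twoSeatProfile {r : ℕ} {b : Ballot (Fin 4)}
    (hb : b ∈ twoSeatProfile r) : b.IsComplete := by
  have h : (increasing 4).IsComplete := isComplete_increasing
  simp only [twoSeatProfile, Multiset.mem_add, Multiset.mem_replicate] at hb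
  obtain (((⟨-, rfl⟩ | ⟨-, rfl⟩) | ⟨-, rfl⟩) | ⟨-, rfl⟩) | ⟨-, rfl⟩ := hb
  exacts [h.promotePair 1 2, h.promote 1, h.promotePair 2 3, h.promote 3, h]

theorem twoSeatProfile_add_replicate (r k : ℕ) :
    twoSeatProfile r + Multiset.replicate k (increasing 4) = twoSeatProfile (r + k) := by
  simp only [twoSeatProfile, add_assoc, Multiset.replicate_add]

theorem tally_twoSeatProfile_univ (r : ℕ) :
    tally (twoSeatProfile r) 1 Finset.univ = ![(r : ℚ), 336, 180, 181] := by
  ext c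
  simp only [twoSeatProfile, tally_add, tally_replicate, Ballot.next_promote,
    Ballot.next_promotePair, next_increasing (Finset.mem_univ _)]
  fin_cases c <;> simp
  norm_num

section Transfer

variable (r : ℕ) (ρ : ℚ)

theorem tally_twoSeatProfile_erase_one :
    tally (twoSeatProfile r) (discount 1 Finset.univ 1 ρ) (Finset.univ.erase 1) =
      ![r + 112 * ρ, 0, 180 + 224 * ρ, 181] := by
  ext c
  have h : (0 : Fin 4) ∈ (Finset.univ.erase 1 : Finset (Fin 4)) := by decide
  simp only [twoSeatProfile, tally_add, tally_replicate, discount, Ballot.next_promote,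
    Ballot.next_promotePair, next_increasing (Finset.mem_univ _), next_increasing h]
  fin_cases c <;> simp <;> ring

theorem tally_twoSeatProfile_erase_three :
    tally (twoSeatProfile r) (discount 1 Finset.univ 1 ρ) ((Finset.univ.erase 1).erase 3) =
      ![r + 112 * ρ + 181, 0, 180 + 224 * ρ, 0] := by
  ext c
  have h : (0 : Fin 4) ∈ ((Finset.univ.erase 1).erase 3 : Finset (Fin 4)) := by decide
  simp only [twoSeatProfile, tally_add, tally_replicate, discount, Ballot.next_promote,
    Ballot.next_promotePair, next_increasing (Finset.mem_univ _), next_increasing h]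
  fin_cases c <;> simp <;> ring

theorem tally_twoSeatProfile_erase_two :
    tally (twoSeatProfile r) (discount 1 Finset.univ 1 ρ) ((Finset.univ.erase 1).erase 2) =
      ![r + 336 * ρ, 0, 0, 361] := by
  ext c
  have h : (0 : Fin 4) ∈ ((Finset.univ.erase 1).erase 2 : Finset (Fin 4)) := by decide
  simp only [twoSeatProfile, tally_add, tally_replicate, discount, Ballot.next_promote,
    Ballot.next_promotePair, next_increasing (Finset.mem_univ _), next_increasing h]
  fin_cases c <;> simp <;> ring

end Transfer

theorem winnersEq_twoSeatProfile_303 : WinnersEq (twoSeatProfile 303) 2 {0, 1} := by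
  have hquota : quota (twoSeatProfile 303) 2 = 334 := by simp [quota, card_twoSeatProfile]
  rw [winnersEq_iff]
  refine State.electsOnly_declare_settled_of_transferSurplus (m := 1) (by decide) (by decide)
    (Finset.mem_univ 1) ?_ ?_ ?_
  · norm_num [hquota, tally_twoSeatProfile_univ]
  · rw [hquota, tally_twoSeatProfile_univ]
    norm_num [Fin.forall_fin_succ]
  refine State.electsOnly_declare_settled_of_eliminate (c := 3) (by decide) (by decide) ?_
    (by decide) ?_ ?_
  · rw [hquota, tally_twoSeatProfile_univ, tally_twoSeatProfile_erase_one]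
    norm_num [Fin.forall_fin_succ]
  · rw [hquota, tally_twoSeatProfile_univ, tally_twoSeatProfile_erase_one]
    simp [Fin.forall_fin_succ]
    norm_num
  refine State.electsOnly_declare_settled_of_full (m := 0) (by decide) ?_ ?_ (by decide)
  all_goals rw [hquota, tally_twoSeatProfile_univ, tally_twoSeatProfile_erase_three]
  · simp only [Matrix.cons_val]
    norm_num
  · simp [Fin.forall_fin_succ]
    norm_num

theorem winnersEq_twoSeatProfile_306 : WinnersEq (twoSeatProfile 306) 2 {1, 3} := by
  have hquota : quota (twoSeatProfile 306) 2 = 335 := by simp [quota, card_twoSeatProfile]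
  rw [winnersEq_iff, Finset.pair_comm]
  refine State.electsOnly_declare_settled_of_transferSurplus (m := 1) (by decide) (by decide)
    (Finset.mem_univ 1) ?_ ?_ ?_
  · norm_num [hquota, tally_twoSeatProfile_univ]
  · rw [hquota, tally_twoSeatProfile_univ]
    norm_num [Fin.forall_fin_succ]
  refine State.electsOnly_declare_settled_of_eliminate (c := 2) (by decide) (by decide) ?_
    (by decide) ?_ ?_
  · rw [hquota, tally_twoSeatProfile_univ, tally_twoSeatProfile_erase_one]
    norm_num [Fin.forall_fin_succ]
  · rw [hquota, tally_twoSeatProfile_univ, tally_twoSeatProfile_erase_one]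
    simp [Fin.forall_fin_succ]
    norm_num
  refine State.electsOnly_declare_settled_of_full (m := 3) (by decide) ?_ ?_ (by decide)
  all_goals rw [hquota, tally_twoSeatProfile_univ, tally_twoSeatProfile_erase_two]
  · simp only [Matrix.cons_val]
    norm_num
  · simp [Fin.forall_fin_succ]
    norm_num

theorem isParadox_twoSeatProfile :
    IsParadox 2 (twoSeatProfile 303) (increasing 4) 3 {0, 1} {1, 3} := by
  refine ⟨fun b => isComplete_of_mem_twoSeatProfile, isComplete_increasing,
    winnersEq_twoSeatProfile_303, ?_, ?_⟩
  · rw [twoSeatProfile_add_replicate]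
    exact winnersEq_twoSeatProfile_306
  · simp only [mem_top_increasing, mem_bottom_increasing]
    decide

end TwoSeats

section Layout

/-- The candidates `m`, `u i` and `v i` for `i < n` are distinct, and there are no others. In the
counts below `m` is elected at once, and then the `v i` are eliminated in favour of the `u i`. -/
structure IsLayout (n : ℕ) (m : C) (u v : ℕ → C) : Prop where
  injOn_survivor : Set.InjOn u (Set.Iio n)
  injOn_loser : Set.InjOn v (Set.Iio n)
  survivor_ne_loser : ∀ i < n, ∀ j < n, u i ≠ v j
  survivor_ne : ∀ i < n, u i ≠ m
  loser_ne : ∀ j < n, v j ≠ m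
  cover : ∀ c, c = m ∨ (∃ i < n, u i = c) ∨ ∃ j < n, v j = c

/-- The candidates `u i` and `v j` for `i, j < n` other than `v 0`, …, `v (k - 1)`. -/
def remaining (n : ℕ) (u v : ℕ → C) (k : ℕ) : Finset C :=
  (Finset.range n).image u ∪ (Finset.Ico k n).image v

/-- For `i, j < n`, a number `T i j` of ballots ranking `x i` and `y j` before all others. -/
def pairProfile (b : Ballot C) (n : ℕ) (x y : ℕ → C) (T : ℕ → ℕ → ℕ) : Profile C :=
  ∑ i ∈ Finset.range n, ∑ j ∈ Finset.range n, Multiset.replicate (T i j) (b.promotePair (x i) (y j))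

section PairProfile

variable {b a : Ballot C} {n : ℕ} {x y : ℕ → C} {T : ℕ → ℕ → ℕ}

theorem exists_eq_of_mem_pairProfile (ha : a ∈ pairProfile b n x y T) :
    ∃ i < n, ∃ j < n, a = b.promotePair (x i) (y j) := by
  simp only [pairProfile, Multiset.mem_sum, Finset.mem_range] at ha
  obtain ⟨i, hi, j, hj, ha⟩ := ha
  exact ⟨i, hi, j, hj, Multiset.eq_of_mem_replicate ha⟩

theorem isComplete_of_mem_pairProfile (hb : b.IsComplete) (ha : a ∈ pairProfile b n x y T) :
    a.IsComplete := by
  obtain ⟨i, -, j, -, rfl⟩ := exists_eq_of_mem_pairProfile ha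
  exact hb.promotePair (x i) (y j)

theorem card_pairProfile (b : Ballot C) (n : ℕ) (x y : ℕ → C) (T : ℕ → ℕ → ℕ) :
    (pairProfile b n x y T).card = ∑ i ∈ Finset.range n, ∑ j ∈ Finset.range n, T i j := by
  simp [pairProfile]

end PairProfile

variable {n : ℕ} {m : C} {u v : ℕ → C} {k : ℕ}

theorem survivor_mem_remaining {j : ℕ} (hj : j < n) : u j ∈ remaining n u v k :=
  Finset.mem_union_left _ (Finset.mem_image_of_mem u (Finset.mem_range.2 hj))

theorem remaining_self : remaining n u v n = (Finset.range n).image u := by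
  simp [remaining]

theorem forall_mem_remaining {p : C → Prop} :
    (∀ d ∈ remaining n u v k, p d) ↔ (∀ j < n, p (u j)) ∧ ∀ l < n, k ≤ l → p (v l) := by
  simp only [remaining, Finset.forall_mem_union, Finset.forall_mem_image, Finset.mem_range,
    Finset.mem_Ico]
  tauto

namespace IsLayout

omit [DecidableEq C] in
theorem symm (L : IsLayout n m u v) : IsLayout n m v u where
  injOn_survivor := L.injOn_loser
  injOn_loser := L.injOn_survivor
  survivor_ne_loser i hi j hj := (L.survivor_ne_loser j hj i hi).symm
  survivor_ne := L.loser_ne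
  loser_ne := L.survivor_ne
  cover c := (L.cover c).imp_right Or.symm

theorem loser_mem_remaining (L : IsLayout n m u v) {l : ℕ} (hl : l < n) :
    v l ∈ remaining n u v k ↔ k ≤ l := by
  simp only [remaining, Finset.mem_union, Finset.mem_image, Finset.mem_range, Finset.mem_Ico]
  constructor
  · rintro (⟨i, hi, h⟩ | ⟨i, ⟨hki, hi⟩, h⟩)
    · exact absurd h (L.survivor_ne_loser i hi l hl)
    · exact L.injOn_loser hi hl h ▸ hki
  · exact fun hkl => .inr ⟨l, ⟨hkl, hl⟩, rfl⟩

theorem card_image_survivor (L : IsLayout n m u v) : ((Finset.range n).image u).card = n := by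
  rw [Finset.card_image_of_injOn (L.injOn_survivor.mono (by simp)), Finset.card_range]

theorem remaining_zero [Fintype C] (L : IsLayout n m u v) :
    remaining n u v 0 = Finset.univ.erase m := by
  ext c
  simp only [remaining, Finset.mem_union, Finset.mem_image, Finset.mem_range, Finset.mem_Ico,
    zero_le, true_and, Finset.mem_erase, Finset.mem_univ, and_true]
  refine ⟨?_, (L.cover c).resolve_left⟩
  rintro (⟨i, hi, rfl⟩ | ⟨i, hi, rfl⟩)
  exacts [L.survivor_ne i hi, L.loser_ne i hi]

theorem notMem_remaining (L : IsLayout n m u v) : m ∉ remaining n u v k := fun hm =>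
  forall_mem_remaining (p := (· ≠ m)).2 ⟨L.survivor_ne, fun l hl _ => L.loser_ne l hl⟩ m hm rfl

theorem remaining_succ (L : IsLayout n m u v) (hk : k < n) :
    remaining n u v (k + 1) = (remaining n u v k).erase (v k) := by
  have hu : v k ∉ (Finset.range n).image u := fun h => by
    obtain ⟨i, hi, h⟩ := Finset.mem_image.1 h
    exact L.survivor_ne_loser i (Finset.mem_range.1 hi) k hk h
  have hv : v k ∉ (Finset.Ico (k + 1) n).image v := fun h => by
    obtain ⟨i, hi, h⟩ := Finset.mem_image.1 h
    have hki := Finset.mem_Ico.1 hi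
    have := L.injOn_loser hki.2 hk h
    omega
  rw [remaining, remaining, ← Finset.insert_Ico_add_one_left_eq_Ico hk, Finset.image_insert,
    Finset.union_insert, Finset.erase_insert]
  exact Finset.notMem_union.2 ⟨hu, hv⟩

end IsLayout

/-- The vote totals of a count in which `n` losing candidates are eliminated one after the other:
`x l` is the total of the `l`-th of them until it is eliminated, `y k j` is the total of the `j`-th
of `n` surviving candidates after `k` eliminations, and `Q` is the quota. -/
structure IsCascade (n Q : ℕ) (x : ℕ → ℕ) (y : ℕ → ℕ → ℕ) : Prop where
  loser_lt_loser : ∀ l < n, ∀ k < l, x k < x l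
  loser_lt_survivor : ∀ k < n, ∀ j < n, x k < y k j
  survivor_lt_quota : ∀ k < n, ∀ j < n, y k j < Q

namespace IsCascade

variable {P : Profile C} {w : Ballot C → ℚ} {Q : ℕ} {x : ℕ → ℕ} {y : ℕ → ℕ → ℕ}

theorem tally_lt (hxy : IsCascade n Q x y)
    (hx : ∀ l < n, ∀ k ≤ l, tally P w (remaining n u v k) (v l) = x l)
    (hy : ∀ k < n, ∀ j < n, tally P w (remaining n u v k) (u j) = y k j) (hk : k < n) :
    ∀ d ∈ remaining n u v k, tally P w (remaining n u v k) d < Q := by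
  refine forall_mem_remaining.2 ⟨fun j hj => ?_, fun l hl hkl => ?_⟩
  · rw [hy k hk j hj]
    exact_mod_cast hxy.survivor_lt_quota k hk j hj
  · rw [hx l hl k hkl]
    exact_mod_cast (hxy.loser_lt_survivor l hl l hl).trans (hxy.survivor_lt_quota l hl l hl)

theorem tally_loser_lt (hxy : IsCascade n Q x y)
    (hx : ∀ l < n, ∀ k ≤ l, tally P w (remaining n u v k) (v l) = x l)
    (hy : ∀ k < n, ∀ j < n, tally P w (remaining n u v k) (u j) = y k j) (hk : k < n) :
    ∀ d ∈ remaining n u v k, d ≠ v k →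
      tally P w (remaining n u v k) (v k) < tally P w (remaining n u v k) d := by
  rw [hx k hk k le_rfl]
  refine forall_mem_remaining.2 ⟨fun j hj _ => ?_, fun l hl hkl hne => ?_⟩
  · rw [hy k hk j hj]
    exact_mod_cast hxy.loser_lt_survivor k hk j hj
  · rw [hx l hl k hkl]
    exact_mod_cast hxy.loser_lt_loser l hl k (hkl.lt_of_ne fun h => hne (h ▸ rfl))

end IsCascade

namespace IsLayout

variable {b : Ballot C} {D E : ℕ → ℕ → ℕ}

theorem next_promotePair_loser (L : IsLayout n m u v) {i j : ℕ} (hi : i < n) (hj : j < n) :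
    (b.promotePair (v i) (u j)).next (remaining n u v k) =
      if k ≤ i then some (v i) else some (u j) := by
  simp only [Ballot.next_promotePair, L.loser_mem_remaining hi, survivor_mem_remaining hj, if_true]

theorem next_promotePair_survivor {i : ℕ} (hi : i < n) (y : C) :
    (b.promotePair (u i) y).next (remaining n u v k) = some (u i) := by
  simp only [Ballot.next_promotePair, survivor_mem_remaining hi, if_true]

variable [Fintype C] {ρ : ℚ}

theorem tally_pairProfile_univ (L : IsLayout n m u v) (T : ℕ → ℕ → ℕ) :
    tally (pairProfile b n u v T) 1 Finset.univ m = 0 := by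
  refine tally_eq_zero fun a ha => ?_
  obtain ⟨i, hi, j, -, rfl⟩ := exists_eq_of_mem_pairProfile ha
  simpa [Ballot.next_promotePair] using L.survivor_ne i hi

theorem tally_pairProfile_loser (L : IsLayout n m u v) {l : ℕ} (hkl : k ≤ l) (hl : l < n) :
    tally (pairProfile b n v u D + pairProfile b n u v E) (discount 1 Finset.univ m ρ)
      (remaining n u v k) (v l) = ∑ j ∈ Finset.range n, (D l j : ℚ) := by
  have hD : ∀ i ∈ Finset.range n, ∀ j ∈ Finset.range n,
      tally (Multiset.replicate (D i j) (b.promotePair (v i) (u j))) (discount 1 Finset.univ m ρ)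
        (remaining n u v k) (v l) = if i = l then (D l j : ℚ) else 0 := fun i hi j hj => by
    rw [Finset.mem_range] at hi hj
    rw [tally_replicate, L.next_promotePair_loser hi hj, discount_promotePair,
      if_neg (L.loser_ne i hi)]
    have hu := L.survivor_ne_loser j hj l hl
    have hv := L.injOn_loser.eq_iff hi hl
    split_ifs <;> simp_all
  have hE : ∀ i ∈ Finset.range n, ∀ j ∈ Finset.range n,
      tally (Multiset.replicate (E i j) (b.promotePair (u i) (v j))) (discount 1 Finset.univ m ρ)
        (remaining n u v k) (v l) = 0 := fun i hi j _ => by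
    rw [Finset.mem_range] at hi
    rw [tally_replicate, next_promotePair_survivor hi, if_neg]
    simpa using L.survivor_ne_loser i hi l hl
  simp only [tally_add, pairProfile, tally_sum]
  rw [Finset.sum_congr rfl fun i hi => Finset.sum_congr rfl (hD i hi),
    Finset.sum_congr rfl fun i hi => Finset.sum_congr rfl (hE i hi)]
  simp [Finset.sum_ite_irrel, hl]

theorem tally_pairProfile_survivor (L : IsLayout n m u v) {l : ℕ} (hk : k ≤ n) (hl : l < n) :
    tally (pairProfile b n v u D + pairProfile b n u v E) (discount 1 Finset.univ m ρ)
      (remaining n u v k) (u l) =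
      ∑ j ∈ Finset.range n, (E l j : ℚ) + ∑ i ∈ Finset.range k, (D i l : ℚ) := by
  have hD : ∀ i ∈ Finset.range n, ∀ j ∈ Finset.range n,
      tally (Multiset.replicate (D i j) (b.promotePair (v i) (u j))) (discount 1 Finset.univ m ρ)
        (remaining n u v k) (u l) = if j = l then if i < k then (D i l : ℚ) else 0 else 0 :=
    fun i hi j hj => by
    rw [Finset.mem_range] at hi hj
    rw [tally_replicate, L.next_promotePair_loser hi hj, discount_promotePair,
      if_neg (L.loser_ne i hi)]
    have hu := L.injOn_survivor.eq_iff hj hl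
    have hv := (L.survivor_ne_loser l hl i hi).symm
    split_ifs <;> first | omega | simp_all
  have hE : ∀ i ∈ Finset.range n, ∀ j ∈ Finset.range n,
      tally (Multiset.replicate (E i j) (b.promotePair (u i) (v j))) (discount 1 Finset.univ m ρ)
        (remaining n u v k) (u l) = if i = l then (E l j : ℚ) else 0 := fun i hi j hj => by
    rw [Finset.mem_range] at hi hj
    rw [tally_replicate, next_promotePair_survivor hi, discount_promotePair,
      if_neg (L.survivor_ne i hi)]
    have hu := L.injOn_survivor.eq_iff hi hl
    split_ifs <;> simp_all
  simp only [tally_add, pairProfile, tally_sum]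
  rw [Finset.sum_congr rfl fun i hi => Finset.sum_congr rfl (hD i hi),
    Finset.sum_congr rfl fun i hi => Finset.sum_congr rfl (hE i hi)]
  have hfilter : (Finset.range n).filter (· < k) = Finset.range k := by
    ext i
    simp only [Finset.mem_filter, Finset.mem_range]
    omega
  simp [Finset.sum_ite_irrel, hl, add_comm, ← Finset.sum_filter, hfilter]

theorem lt_card_erase (L : IsLayout n m u v) (hn : 0 < n) : n < (Finset.univ.erase m).card := by
  have hssubset : (Finset.range n).image u ⊂ remaining n u v 0 := by
    refine ⟨Finset.subset_union_left, fun h => ?_⟩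
    obtain ⟨i, hi, h⟩ := Finset.mem_image.1 (h ((L.loser_mem_remaining hn).2 le_rfl))
    exact L.survivor_ne_loser i (Finset.mem_range.1 hi) 0 hn h
  rw [← L.remaining_zero]
  exact L.card_image_survivor.symm.trans_lt (Finset.card_lt_card hssubset)

theorem winnersEq_of_isCascade (L : IsLayout n m u v) (hn : 0 < n) {P : Profile C} {T Q : ℕ}
    {x : ℕ → ℕ} {y : ℕ → ℕ → ℕ} (hQ : quota P (n + 1) = Q) (hT : tally P 1 Finset.univ m = T)
    (hQT : Q ≤ T) (hxy : IsCascade n Q x y)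
    (hx : ∀ l < n, ∀ k ≤ l, tally P (discount 1 Finset.univ m ((T - Q) / T))
      (remaining n u v k) (v l) = x l)
    (hy : ∀ k < n, ∀ j < n, tally P (discount 1 Finset.univ m ((T - Q) / T))
      (remaining n u v k) (u j) = y k j) :
    WinnersEq P (n + 1) (insert m ((Finset.range n).image u)) := by
  have hQT' : (Q : ℚ) ≤ T := by exact_mod_cast hQT
  have hρ : 0 ≤ ((T : ℚ) - Q) / T := div_nonneg (sub_nonneg.2 hQT') T.cast_nonneg
  rw [winnersEq_iff, Finset.insert_eq, ← remaining_self (v := v)]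
  refine State.electsOnly_declare_settled_of_transferSurplus (m := m) ?_ ?_ (Finset.mem_univ m) ?_
    ?_ ?_
  · simpa using hn
  · have := L.lt_card_erase hn
    simp only [insert_empty_eq, Finset.card_singleton]
    omega
  · rwa [hQ, hT]
  · intro c hc hcm
    have hw : tally P 1 Finset.univ c ≤ _ :=
      tally_le_tally_discount (fun _ => zero_le_one) hρ hc hcm
    rw [← L.remaining_zero] at hw
    rw [hQ]
    refine hw.trans_lt (hxy.tally_lt hx hy hn c ?_)
    rw [L.remaining_zero]
    exact Finset.mem_erase.2 ⟨hcm, hc⟩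
  · rw [hQ, hT, ← L.remaining_zero]
    refine State.electsOnly_declare_settled_of_eliminations
      (fun k hk => (L.loser_mem_remaining hk).2 le_rfl) (fun k hk => L.remaining_succ hk) ?_ ?_
      (fun k hk => by rw [hQ]; exact hxy.tally_lt hx hy hk)
      fun k hk => hxy.tally_loser_lt hx hy hk
    · simpa using hn
    · simp [remaining_self, L.card_image_survivor, add_comm]

end IsLayout

end Layout

/-- The vote totals in a row of `q + 2` candidates who are not elected yet. If the first winner has
a surplus of `2 * t`, then, after its transfer, this is the total of the `i`-th candidate of the
losing row, and with `t + 1` in place of `t` that of the `i`-th candidate of the surviving row. The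
total of the last candidate is the parameter `l`. -/
def firstVotes (q h t l i : ℕ) : ℕ :=
  if i = 0 then h + 2 + t - (q * q + q) else if i ≤ q then h + 2 * i + 1 else l

/-- The number of ballots passing from the `i`-th loser to the `j`-th survivor of the cascade, if
the first winner has a surplus of `2 * t`. It is chosen such that the survivors `1`, …, `i - 1` and
`q + 1` have come up to one vote below the quota `2 * h + 3 - 2 * t` when the `i`-th loser, `i ≠ 0`,
is eliminated, and the survivor `0` as well when `i = q + 1`. -/
def flow (q h t l i j : ℕ) : ℕ :=
  if i = 0 then
    if j = 0 then h - (q + 1 + t) ^ 2 else if j ≤ q then 1 else 3 + 2 * t * (q + 2)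
  else if i ≤ q then
    if j = i then h - 2 * (i + t) else if j = 0 then 4 * i + 2 * t + 1 else 0
  else if j = i then l else 0

/-- The vote total of the `j`-th survivor of that cascade after `k` eliminations. -/
def survivorVotes (q h t l k j : ℕ) : ℕ :=
  firstVotes q h (t + 1) (2 * h - (1 + 2 * t * (q + 3))) j + ∑ i ∈ Finset.range k, flow q h t l i j

section Flow

variable {q h t l : ℕ}

theorem sum_firstVotes (q h t l : ℕ) :
    ∑ i ∈ Finset.range (q + 2), firstVotes q h t l i =
      h + 2 + t - (q * q + q) + q * (h + q + 2) + l := by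
  have hmiddle : ∀ n ≤ q, ∑ i ∈ Finset.range n, firstVotes q h t l (i + 1) = n * (h + n + 2) := by
    intro n hn
    induction n with
    | zero => simp
    | succ n ih =>
      rw [Finset.sum_range_succ, ih (by omega), firstVotes, if_neg (by omega), if_pos hn]
      ring
  rw [Finset.sum_range_succ, Finset.sum_range_succ', hmiddle q le_rfl, add_comm (q * _)]
  simp [firstVotes]

theorem sum_flow (hh : 4 * (q + 2) ^ 2 ≤ h) (ht : t ≤ 1) {i : ℕ} (hi : i < q + 2) :
    ∑ j ∈ Finset.range (q + 2), flow q h t l i j = firstVotes q h t l i := by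
  obtain rfl | hi0 := eq_or_ne i 0
  · have hmiddle : ∀ j ∈ Finset.range q, flow q h t l 0 (j + 1) = 1 := fun j hj => by
      simp [flow, Nat.succ_le_iff.2 (Finset.mem_range.1 hj)]
    rw [Finset.sum_range_succ, Finset.sum_range_succ', Finset.sum_congr rfl hmiddle]
    simp only [flow, firstVotes, Finset.sum_const, Finset.card_range]
    interval_cases t <;> simp <;> grind
  obtain hiq | rfl := Nat.lt_succ_iff_lt_or_eq.1 hi
  · have hsplit : ∀ j ∈ Finset.range (q + 2), flow q h t l i j =
        (if j = i then h - 2 * (i + t) else 0) + if j = 0 then 4 * i + 2 * t + 1 else 0 :=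
      fun j _ => by
        rw [flow, if_neg hi0, if_pos (by omega)]
        split_ifs <;> omega
    have hmem : i ∈ Finset.range (q + 2) := Finset.mem_range.2 hi
    rw [Finset.sum_congr rfl hsplit, Finset.sum_add_distrib, Finset.sum_ite_eq_of_mem' _ _ _ hmem,
      Finset.sum_ite_eq_of_mem' _ _ _ (by simp), firstVotes, if_neg hi0, if_pos (by omega)]
    have hle : 2 * (i + t) ≤ h := by nlinarith
    omega
  · simp [flow, firstVotes]

theorem sum_range_flow_zero {K : ℕ} (hK : K ≤ q) :
    ∑ i ∈ Finset.range (K + 1), flow q h t l i 0 =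
      h - (q + 1 + t) ^ 2 + K * (2 * K + 3 + 2 * t) := by
  induction K with
  | zero => simp [flow]
  | succ K ih =>
    rw [Finset.sum_range_succ, ih (by omega), flow, if_neg (by omega), if_pos hK,
      if_neg (by omega), if_pos rfl]
    ring

theorem sum_range_flow_middle {K j : ℕ} (hK : K ≤ q) (hj : j ≠ 0) (hjq : j ≤ q) :
    ∑ i ∈ Finset.range (K + 1), flow q h t l i j = 1 + if j ≤ K then h - 2 * (j + t) else 0 := by
  induction K with
  | zero => simp [flow, hj, hjq]
  | succ K ih =>
    have hflow : flow q h t l (K + 1) j = if j = K + 1 then h - 2 * (j + t) else 0 := by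
      rw [flow, if_neg (by omega), if_pos hK, if_neg hj]
      split_ifs with hjK
      · rw [hjK]
      · rfl
    rw [Finset.sum_range_succ, ih (by omega), hflow]
    split_ifs <;> omega

theorem sum_range_flow_last {K : ℕ} (hK : K ≤ q) :
    ∑ i ∈ Finset.range (K + 1), flow q h t l i (q + 1) = 3 + 2 * t * (q + 2) := by
  induction K with
  | zero => simp [flow]
  | succ K ih =>
    rw [Finset.sum_range_succ, ih (by omega), flow, if_neg (by omega), if_pos hK,
      if_neg (by omega), if_neg (by omega), add_zero]

theorem firstVotes_lt_firstVotes (hh : 4 * (q + 2) ^ 2 ≤ h) (ht : t ≤ 1) {i k : ℕ}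
    (hi : i < q + 2) (hk : k < i) :
    firstVotes q h t (2 * h + 1 - 2 * t) k < firstVotes q h t (2 * h + 1 - 2 * t) i := by
  simp only [firstVotes]
  have hlarge : 2 * q + 5 ≤ h := by nlinarith
  split_ifs <;> omega

theorem survivorVotes_succ_zero (hh : 4 * (q + 2) ^ 2 ≤ h) (ht : t ≤ 1) {K : ℕ} (hK : K ≤ q) :
    survivorVotes q h t l (K + 1) 0 + q * (2 * q + 3 + 2 * t) =
      2 * h + 2 - 2 * t + K * (2 * K + 3 + 2 * t) := by
  rw [survivorVotes, sum_range_flow_zero hK, firstVotes, if_pos rfl]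
  interval_cases t <;> grind

theorem survivorVotes_succ_middle (hh : 4 * (q + 2) ^ 2 ≤ h) (ht : t ≤ 1) {K j : ℕ} (hK : K ≤ q)
    (hj : j ≠ 0) (hjq : j ≤ q) :
    survivorVotes q h t l (K + 1) j = if j ≤ K then 2 * h + 2 - 2 * t else h + 2 * j + 2 := by
  have hle : 2 * (j + t) ≤ h := by nlinarith
  rw [survivorVotes, sum_range_flow_middle hK hj hjq, firstVotes, if_neg hj, if_pos hjq]
  split_ifs <;> omega

theorem survivorVotes_succ_last (hh : 4 * (q + 2) ^ 2 ≤ h) (ht : t ≤ 1) {K : ℕ} (hK : K ≤ q) :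
    survivorVotes q h t l (K + 1) (q + 1) = 2 * h + 2 - 2 * t := by
  rw [survivorVotes, sum_range_flow_last hK, firstVotes, if_neg (by omega), if_neg (by omega)]
  interval_cases t <;> grind

theorem firstVotes_zero_lt_survivorVotes (hh : 4 * (q + 2) ^ 2 ≤ h) (ht : t ≤ 1) (j : ℕ) :
    firstVotes q h t (2 * h + 1 - 2 * t) 0 < survivorVotes q h t l 0 j := by
  simp only [survivorVotes, firstVotes, Finset.range_zero, Finset.sum_empty]
  interval_cases t <;> grind

theorem firstVotes_le (hh : 4 * (q + 2) ^ 2 ≤ h) (ht : t ≤ 1) (i : ℕ) :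
    firstVotes q h t (2 * h + 1 - 2 * t) i ≤ 2 * h + 1 - 2 * t := by
  have hlarge : 2 * q + 4 ≤ h := by nlinarith
  rw [firstVotes]
  split_ifs <;> omega

theorem firstVotes_lt_survivorVotes (hh : 4 * (q + 2) ^ 2 ≤ h) (ht : t ≤ 1) {k j : ℕ}
    (hk : k < q + 2) (hj : j < q + 2) :
    firstVotes q h t (2 * h + 1 - 2 * t) k < survivorVotes q h t l k j := by
  have hlarge : 2 * q + 4 ≤ h := by nlinarith
  rcases k with _ | K
  · exact firstVotes_zero_lt_survivorVotes hh ht j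
  have hKq : K ≤ q := by omega
  have htop := firstVotes_le hh ht (K + 1)
  have hstep : K < q → firstVotes q h t (2 * h + 1 - 2 * t) (K + 1) = h + 2 * K + 3 := fun hK => by
    simp [firstVotes, hK]; ring
  obtain rfl | hj0 := eq_or_ne j 0
  · have hvotes := survivorVotes_succ_zero (l := l) hh ht hKq
    obtain hK | rfl := hKq.lt_or_eq
    · have hfirst : q * (2 * q + 3 + 2 * t) + 2 * q + 4 ≤ h := by nlinarith
      have hsuccVotes := hstep hK
      omega
    · omega
  obtain hjq | rfl := Nat.lt_succ_iff_lt_or_eq.1 hj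
  · rw [survivorVotes_succ_middle hh ht hKq hj0 (by omega)]
    split_ifs <;> omega
  · rw [survivorVotes_succ_last hh ht hKq]
    omega

theorem survivorVotes_lt (hh : 4 * (q + 2) ^ 2 ≤ h) (ht : t ≤ 1) {k j : ℕ}
    (hk : k < q + 2) (hj : j < q + 2) : survivorVotes q h t l k j < 2 * h + 3 - 2 * t := by
  have hlarge : 2 * q + 4 ≤ h := by nlinarith
  rcases k with _ | K
  · simp only [survivorVotes, firstVotes, Finset.range_zero, Finset.sum_empty]
    interval_cases t <;> grind
  have hKq : K ≤ q := by omega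
  obtain rfl | hj0 := eq_or_ne j 0
  · have hvotes := survivorVotes_succ_zero (l := l) hh ht hKq
    have hmono : K * (2 * K + 3 + 2 * t) ≤ q * (2 * q + 3 + 2 * t) := by gcongr
    omega
  obtain hjq | rfl := Nat.lt_succ_iff_lt_or_eq.1 hj
  · rw [survivorVotes_succ_middle hh ht hKq hj0 (by omega)]
    split_ifs <;> omega
  · rw [survivorVotes_succ_last hh ht hKq]
    omega

theorem isCascade_survivorVotes (hh : 4 * (q + 2) ^ 2 ≤ h) (ht : t ≤ 1) :
    IsCascade (q + 2) (2 * h + 3 - 2 * t) (firstVotes q h t (2 * h + 1 - 2 * t))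
      (survivorVotes q h t l) where
  loser_lt_loser _ hi _ hk := firstVotes_lt_firstVotes hh ht hi hk
  loser_lt_survivor _ hk _ hj := firstVotes_lt_survivorVotes hh ht hk hj
  survivor_lt_quota _ hk _ hj := survivorVotes_lt hh ht hk hj

end Flow

section CascadeCount

variable [Fintype C] {b : Ballot C} {m : C} {u v : ℕ → C} {q h t t' l l' : ℕ} {R : Profile C}

theorem IsLayout.winnersEq_of_flow (L : IsLayout (q + 2) m u v) (hh : 4 * (q + 2) ^ 2 ≤ h)
    (ht : t ≤ 1) (ht' : t' ≤ 1)
    (hQ : quota (R + (pairProfile b (q + 2) v u (flow q h t l) +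
      pairProfile b (q + 2) u v (flow q h t' l'))) (q + 3) = 2 * h + 3 - 2 * t)
    (hm : tally R 1 Finset.univ m = (2 * h + 3 : ℕ))
    (hv : ∀ i < q + 2, ∀ k ≤ i,
      tally R (discount 1 Finset.univ m (2 * t / (2 * h + 3))) (remaining (q + 2) u v k) (v i) +
        firstVotes q h t l i = firstVotes q h t (2 * h + 1 - 2 * t) i)
    (hu : ∀ k < q + 2, ∀ j < q + 2,
      tally R (discount 1 Finset.univ m (2 * t / (2 * h + 3))) (remaining (q + 2) u v k) (u j) +
        firstVotes q h t' l' j = firstVotes q h (t + 1) (2 * h - (1 + 2 * t * (q + 3))) j) :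
    WinnersEq (R + (pairProfile b (q + 2) v u (flow q h t l) +
      pairProfile b (q + 2) u v (flow q h t' l'))) (q + 3)
      (insert m ((Finset.range (q + 2)).image u)) := by
  have hρ : (((2 * h + 3 : ℕ) : ℚ) - (2 * h + 3 - 2 * t : ℕ)) / (2 * h + 3 : ℕ) =
      2 * t / (2 * h + 3) := by
    rw [Nat.cast_sub (by omega)]
    push_cast
    ring
  refine L.winnersEq_of_isCascade (by omega) hQ (T := 2 * h + 3) ?_ (Nat.sub_le _ _)
    (isCascade_survivorVotes (l := l) hh ht) ?_ ?_
  · rw [tally_add, hm, tally_add, L.symm.tally_pairProfile_univ, L.tally_pairProfile_univ, add_zero,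
      add_zero]
  · intro i hi k hki
    rw [hρ, tally_add, L.tally_pairProfile_loser hki hi, ← hv i hi k hki, ← sum_flow hh ht hi]
    push_cast
    rfl
  · intro k hk j hj
    rw [hρ, tally_add, L.tally_pairProfile_survivor hk.le hj, survivorVotes, Nat.cast_add,
      ← hu k hk j hj, ← sum_flow hh ht' hj]
    push_cast
    ring

end CascadeCount

section LargeProfile

/-- The candidate elected first. -/
def middle (n : ℕ) : Fin (2 * n + 1) := ⟨n, by omega⟩

/-- The candidates below `middle n`, in decreasing order. -/
def lower (n i : ℕ) : Fin (2 * n + 1) := ⟨n - 1 - i, by omega⟩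

/-- The candidates above `middle n`, in increasing order. -/
def upper (n i : ℕ) : Fin (2 * n + 1) := (lower n i).rev

section Middle

variable {n : ℕ} {c : Fin (2 * n + 1)}

theorem mem_image_lower : c ∈ (Finset.range n).image (lower n) ↔ c < middle n := by
  simp only [Finset.mem_image, Finset.mem_range, Fin.ext_iff, Fin.lt_def, lower, middle]
  exact ⟨fun ⟨i, hi, hc⟩ => by omega, fun hc => ⟨n - 1 - c, by omega, by omega⟩⟩

theorem mem_image_upper : c ∈ (Finset.range n).image (upper n) ↔ middle n < c := by
  simp only [Finset.mem_image, Finset.mem_range, Fin.ext_iff, Fin.lt_def, upper, lower, middle,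
    Fin.val_rev]
  exact ⟨fun ⟨i, hi, hc⟩ => by omega, fun hc => ⟨c - (n + 1), by omega, by omega⟩⟩

theorem insert_middle_image_lower (n : ℕ) :
    insert (middle n) ((Finset.range n).image (lower n)) = Finset.Iic (middle n) := by
  ext c
  rw [Finset.mem_insert, mem_image_lower, Finset.mem_Iic, le_iff_eq_or_lt]

theorem insert_middle_image_upper (n : ℕ) :
    insert (middle n) ((Finset.range n).image (upper n)) = Finset.Ici (middle n) := by
  ext c
  rw [Finset.mem_insert, mem_image_upper, Finset.mem_Ici, le_iff_eq_or_lt, eq_comm]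

theorem lower_injOn (n : ℕ) : Set.InjOn (lower n) (Set.Iio n) := fun i hi j hj h => by
  simp only [lower, Fin.mk.injEq, Set.mem_Iio] at h hi hj
  omega

theorem isLayout_lower_upper (n : ℕ) : IsLayout n (middle n) (lower n) (upper n) := by
  have hlower : ∀ i < n, lower n i < middle n := fun i hi =>
    mem_image_lower.1 (Finset.mem_image_of_mem _ (Finset.mem_range.2 hi))
  have hupper : ∀ i < n, middle n < upper n i := fun i hi =>
    mem_image_upper.1 (Finset.mem_image_of_mem _ (Finset.mem_range.2 hi))
  exact {
    injOn_survivor := lower_injOn n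
    injOn_loser := Fin.rev_injective.comp_injOn (lower_injOn n)
    survivor_ne_loser := fun i hi j hj => ((hlower i hi).trans (hupper j hj)).ne
    survivor_ne := fun i hi => (hlower i hi).ne
    loser_ne := fun j hj => (hupper j hj).ne'
    cover := fun c => by
      simpa [← mem_image_lower, ← mem_image_upper, or_left_comm] using lt_trichotomy c (middle n) }

end Middle

/-- A profile for `q + 3` seats and the quota `2 * h + 1`, in which `middle (q + 2)` is elected
first with two votes more, which go to `lower (q + 2) 0`. The tables `flow` describe the cascade in
which the upper candidates lose and, with the quota raised by two votes, the one in which the lower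
candidates do. Here the last lower candidate is `2 * (q + 4)` votes short of its total in the latter
count, in which the ballots added go to it. -/
def largeProfile (q h : ℕ) : Profile (Fin (2 * (q + 2) + 1)) :=
  Multiset.replicate (2 * h + 3) ((increasing _).promotePair (middle (q + 2)) (lower (q + 2) 0)) +
  (pairProfile (increasing _) (q + 2) (upper (q + 2)) (lower (q + 2)) (flow q h 1 (2 * h - 1)) +
  pairProfile (increasing _) (q + 2) (lower (q + 2)) (upper (q + 2))
    (flow q h 0 (2 * h - (2 * q + 7))))

section Count

variable {q h : ℕ}

theorem isComplete_of_mem_largeProfile {b : Ballot (Fin (2 * (q + 2) + 1))}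
    (hb : b ∈ largeProfile q h) : b.IsComplete := by
  simp only [largeProfile, Multiset.mem_add] at hb
  obtain hb | hb | hb := hb
  · exact Multiset.eq_of_mem_replicate hb ▸ isComplete_increasing.promotePair _ _
  · exact isComplete_of_mem_pairProfile isComplete_increasing hb
  · exact isComplete_of_mem_pairProfile isComplete_increasing hb

theorem card_largeProfile (hh : 4 * (q + 2) ^ 2 ≤ h) :
    (largeProfile q h).card = (q + 4) * (2 * h) := by
  have hcard : ∀ {t l : ℕ}, t ≤ 1 → ∑ i ∈ Finset.range (q + 2), ∑ j ∈ Finset.range (q + 2),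
      flow q h t l i j = h + 2 + t - (q * q + q) + q * (h + q + 2) + l := fun ht => by
    rw [← sum_firstVotes]
    exact Finset.sum_congr rfl fun i hi => sum_flow hh ht (Finset.mem_range.1 hi)
  rw [largeProfile, Multiset.card_add, Multiset.card_add, Multiset.card_replicate,
    card_pairProfile, card_pairProfile, hcard le_rfl, hcard zero_le_one]
  grind

theorem winnersEq_largeProfile (hh : 4 * (q + 2) ^ 2 ≤ h) :
    WinnersEq (largeProfile q h) (q + 3) (Finset.Iic (middle (q + 2))) := by
  have hQ : quota (largeProfile q h) (q + 3) = 2 * h + 1 := by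
    rw [quota, card_largeProfile hh, Nat.mul_div_cancel_left _ (by omega)]
  have L := isLayout_lower_upper (q + 2)
  have hnext : ∀ k, ((increasing _).promotePair (middle (q + 2)) (lower (q + 2) 0)).next
      (remaining (q + 2) (lower (q + 2)) (upper (q + 2)) k) = some (lower (q + 2) 0) := fun k => by
    rw [Ballot.next_promotePair, if_neg L.notMem_remaining,
      if_pos (survivor_mem_remaining (by omega))]
  rw [← insert_middle_image_lower]
  refine L.winnersEq_of_flow hh le_rfl zero_le_one hQ ?_ ?_ ?_
  · rw [tally_replicate, Ballot.next_promotePair, if_pos (Finset.mem_univ _), if_pos rfl,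
      Pi.one_apply, mul_one]
  · intro i hi k _
    rw [tally_replicate, hnext, if_neg (by simpa using L.survivor_ne_loser 0 (by omega) i hi),
      zero_add]
    rfl
  · intro k _ j hj
    have hsurplus : ((2 * h + 3 : ℕ) : ℚ) * (2 * (1 : ℕ) / (2 * h + 3)) = (2 : ℕ) := by
      push_cast
      field_simp
    have hzero := L.injOn_survivor.eq_iff (show 0 < q + 2 by omega) hj
    rw [tally_replicate, hnext, discount_promotePair, if_pos rfl, hsurplus]
    simp only [Option.some.injEq, hzero, firstVotes, eq_comm (a := 0)]
    have hle : q * q + q ≤ h := by nlinarith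
    split_ifs <;> norm_cast <;> omega

theorem largeProfile_add_replicate (q h k : ℕ) :
    largeProfile q h + Multiset.replicate k (increasing _) =
      (Multiset.replicate (2 * h + 3)
        ((increasing _).promotePair (middle (q + 2)) (lower (q + 2) 0)) +
        Multiset.replicate k (increasing _)) +
      (pairProfile (increasing _) (q + 2) (lower (q + 2)) (upper (q + 2))
        (flow q h 0 (2 * h - (2 * q + 7))) +
        pairProfile (increasing _) (q + 2) (upper (q + 2)) (lower (q + 2))
          (flow q h 1 (2 * h - 1))) := by
  rw [largeProfile]
  abel

theorem next_increasing_remaining {k : ℕ} (hk : k < q + 2) :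
    (increasing _).next (remaining (q + 2) (upper (q + 2)) (lower (q + 2)) k) =
      some (lower (q + 2) (q + 1)) := by
  have hmem := ((isLayout_lower_upper (q + 2)).symm.loser_mem_remaining
    (show q + 1 < q + 2 by omega)).2 (Nat.lt_succ_iff.1 hk)
  have hlast : lower (q + 2) (q + 1) = 0 := by simp [lower]
  rw [hlast] at hmem ⊢
  exact next_increasing hmem

theorem winnersEq_largeProfile_add_replicate (hh : 4 * (q + 2) ^ 2 ≤ h) :
    WinnersEq (largeProfile q h + Multiset.replicate (2 * (q + 4)) (increasing _)) (q + 3)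
      (Finset.Ici (middle (q + 2))) := by
  have hQ : quota (largeProfile q h + Multiset.replicate (2 * (q + 4)) (increasing _)) (q + 3) =
      2 * h + 3 := by
    rw [quota, Multiset.card_add, card_largeProfile hh, Multiset.card_replicate,
      mul_comm 2 (q + 4), ← mul_add, Nat.mul_div_cancel_left _ (by omega)]
  have hnext : (increasing _).next Finset.univ ≠ some (middle (q + 2)) := by
    simp [next_increasing, Fin.ext_iff, middle]
  have hworth : discount 1 Finset.univ (middle (q + 2)) 0 (increasing _) = 1 := if_neg hnext
  have L := (isLayout_lower_upper (q + 2)).symm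
  rw [largeProfile_add_replicate] at hQ ⊢
  rw [← insert_middle_image_upper]
  refine L.winnersEq_of_flow hh zero_le_one le_rfl hQ ?_ ?_ ?_
  · rw [tally_add, tally_replicate, tally_replicate, if_neg hnext, Ballot.next_promotePair,
      if_pos (Finset.mem_univ _), if_pos rfl, Pi.one_apply, mul_one, add_zero]
  · intro i hi k hki
    have hlast := L.injOn_loser.eq_iff (show q + 1 < q + 2 by omega) hi
    rw [tally_add, tally_replicate, tally_replicate]
    simp only [Nat.cast_zero, mul_zero, zero_div, discount_promotePair, if_true, ite_self,
      next_increasing_remaining (hki.trans_lt hi), hworth, Option.some.injEq, hlast, firstVotes]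
    have hle : 2 * q + 7 ≤ 2 * h := by nlinarith
    split_ifs <;> norm_cast <;> omega
  · intro k hk j hj
    have hlast := (L.survivor_ne_loser j hj (q + 1) (by omega)).symm
    rw [tally_add, tally_replicate, tally_replicate]
    simp only [Nat.cast_zero, mul_zero, zero_mul, zero_div, discount_promotePair, if_true, ite_self,
      next_increasing_remaining hk, Option.some.injEq, hlast, if_false, zero_add, add_zero]

theorem isParadox_largeProfile (hh : 4 * (q + 2) ^ 2 ≤ h) :
    IsParadox (q + 3) (largeProfile q h) (increasing _) (2 * (q + 4)) (Finset.Iic (middle (q + 2)))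
      (Finset.Ici (middle (q + 2))) := by
  refine ⟨fun b => isComplete_of_mem_largeProfile, isComplete_increasing,
    winnersEq_largeProfile hh, winnersEq_largeProfile_add_replicate hh, fun c hc => ?_, ?_,
    fun c hc => ?_, fun c hc => ?_⟩
  · rw [mem_top_increasing]
    have hcm : (c : ℕ) ≤ q + 2 := (Finset.mem_Iic.1 hc : c ≤ middle (q + 2))
    omega
  · rw [Finset.card_eq_one]
    exact ⟨middle (q + 2), by ext c; simp [le_antisymm_iff]⟩
  · rw [mem_top_increasing] at hc
    intro hcm
    have hcm' : q + 2 ≤ (c : ℕ) := (Finset.mem_Ici.1 hcm : middle (q + 2) ≤ c)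
    omega
  · rw [mem_bottom_increasing] at hc
    have hcm : q + 2 ≤ (c : ℕ) := by omega
    exact Finset.mem_Ici.2 hcm

end Count

end LargeProfile

theorem four_mul_sq_le_five_mul_ten_pow (n : ℕ) : 4 * n ^ 2 ≤ 5 * 10 ^ n := by
  have hsq : n ^ 2 ≤ 10 ^ n := calc
    n ^ 2 ≤ (2 ^ n) ^ 2 := by gcongr; exact Nat.lt_two_pow_self.le
    _ = 4 ^ n := by rw [← pow_mul, mul_comm, pow_mul]; norm_num
    _ ≤ 10 ^ n := by gcongr; norm_num
  omega

end STV

theorem proposition2 (S : ℕ) (hS : 1 < S) :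
    ∃ (n : ℕ) (P : STV.Profile (Fin n)) (b : STV.Ballot (Fin n)) (k : ℕ)
      (W W' : Finset (Fin n)),
      -- the size of the construction
      (S = 2 → n = 4 ∧ P.card = 1000 ∧ k = 3) ∧
      (2 < S → n = 2 * S - 1 ∧ P.card = (S + 1) * 10 ^ S ∧ k = 2 * (S + 1)) ∧
      -- all ballots rank all candidates
      (∀ a ∈ P, a.IsComplete) ∧ b.IsComplete ∧
      -- the winner sets before and after adding `k` ballots of the form `b`
      STV.WinnersEq P S W ∧ STV.WinnersEq (P + Multiset.replicate k b) S W' ∧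
      -- the original winners are ranked in the top `S` slots
      (∀ c ∈ W, c ∈ b.top S) ∧
      -- exactly one of them survives, and the top `S - 1` candidates do not win
      (W ∩ W').card = 1 ∧ (∀ c ∈ b.top (S - 1), c ∉ W') ∧
      -- the bottom `S - 1` candidates win
      (∀ c ∈ b.bottom (S - 1), c ∈ W') := by
  obtain rfl | hS2 := eq_or_ne S 2
  · exact ⟨4, STV.twoSeatProfile 303, STV.increasing 4, 3, {0, 1}, {1, 3},
      fun _ => ⟨rfl, STV.card_twoSeatProfile 303, rfl⟩, fun h => absurd h (lt_irrefl 2),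
      STV.isParadox_twoSeatProfile⟩
  · obtain ⟨q, rfl⟩ : ∃ q, S = q + 3 := ⟨S - 3, by omega⟩
    have hh := STV.four_mul_sq_le_five_mul_ten_pow (q + 2)
    refine ⟨2 * (q + 2) + 1, STV.largeProfile q (5 * 10 ^ (q + 2)), STV.increasing _, 2 * (q + 4),
      Finset.Iic (STV.middle (q + 2)), Finset.Ici (STV.middle (q + 2)),
      fun h => absurd h hS2, fun _ => ⟨by omega, ?_, rfl⟩, STV.isParadox_largeProfile hh⟩
    rw [STV.card_largeProfile hh]
    ring
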